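/- For a sequence $(c_k)_{k\ge 0}$ in a commutative ring and $n\ge 0$ let $H_n(c_k)=\det(c_{i+j})_{0\le i,j\le n}$, a determinant of size $n+1$ whose sequence begins at $k=0$. Let the Euler numbers $E_n\in\mathbb{Q}$ and the Euler polynomials $E_n(x)\in\mathbb{Q}[x]$ be defined by $$\frac{2}{e^t+e^{-t}}=\sum_{n=0}^\infty E_n\frac{t^n}{n!},\qquad \frac{2e^{xt}}{e^t+1}=\sum_{n=0}^\infty E_n(x)\frac{t^n}{n!}.$$ Let $(kE_{k-1})_{k\ge 0}$ and $(kE_{k-1}(x))_{k\ge 0}$ be the sequences of numbers, respectively polynomials in the variable $x$, with these terms for $k\ge 1$ and with term $0$ for $k=0$. Then for all integers $m\ge 0$ we have $$H_{2m}\big(kE_{k-1}(x)\big)=H_{2m}\big(kE_{k-1}\big)=0,$$ $$H_{2m+1}\big(kE_{k-1}(x)\big)=(-1)^{m+1}\prod_{\ell=1}^m \ell!^{8},\qquad H_{2m+1}\big(kE_{k-1}\big)=(-1)^{m+1}2^{4m(m+1)}\prod_{\ell=1}^m \ell!^{8}.$$ Here the identities involving $x$ are identities in $\mathbb{Q}[x]$.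 -/

import Mathlib

open scoped Nat

namespace EulerHankel

/-- The `n`-th Hankel determinant `H_n(c) = det (c_{i+j})_{0 ≤ i,j ≤ n}` of a sequence
`c = (c_0, c_1, …)`; the matrix has size `n + 1`. -/
def hankelDet {R : Type*} [CommRing R] (n : ℕ) (c : ℕ → R) : R :=
  (Matrix.of fun i j : Fin (n + 1) => c ((i : ℕ) + (j : ℕ))).det

/-- The exponential generating function `2 / (e^t + e^{-t})` of the Euler numbers, as a formal
power series over `ℚ`. -/
noncomputable def eulerNumberGF : PowerSeries ℚ :=
  2 * (PowerSeries.exp ℚ + PowerSeries.evalNegHom (PowerSeries.exp ℚ))⁻¹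

/-- The denominator is invertible, so `eulerNumberGF` is a genuine quotient. -/
theorem eulerNumberGF_mul :
    eulerNumberGF * (PowerSeries.exp ℚ + PowerSeries.evalNegHom (PowerSeries.exp ℚ)) = 2 := by
  rw [eulerNumberGF, mul_assoc, PowerSeries.inv_mul_cancel, mul_one]
  rw [map_add, PowerSeries.constantCoeff_exp, ← PowerSeries.coeff_zero_eq_constantCoeff_apply,
    PowerSeries.evalNegHom, PowerSeries.coeff_rescale, pow_zero, one_mul,
    PowerSeries.coeff_zero_eq_constantCoeff_apply, PowerSeries.constantCoeff_exp]
  norm_num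

/-- The Euler numbers: `2 / (e^t + e^{-t}) = ∑ E_n t^n / n!`. -/
noncomputable def eulerNumber (n : ℕ) : ℚ :=
  (n ! : ℚ) * PowerSeries.coeff n eulerNumberGF

/-- The exponential generating function `2 e^{xt} / (e^t + 1)` of the Euler polynomials, as a
formal power series in `t` over `ℚ[x]`. -/
noncomputable def eulerPolyGF : PowerSeries (Polynomial ℚ) :=
  PowerSeries.map Polynomial.C (2 * (PowerSeries.exp ℚ + 1)⁻¹) *
    PowerSeries.rescale Polynomial.X (PowerSeries.exp (Polynomial ℚ))

/-- The denominator is invertible, so `eulerPolyGF` is a genuine quotient. -/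
theorem eulerPolyGF_mul :
    eulerPolyGF * (PowerSeries.exp (Polynomial ℚ) + 1) =
      2 * PowerSeries.rescale Polynomial.X (PowerSeries.exp (Polynomial ℚ)) := by
  have h : (2 * (PowerSeries.exp ℚ + 1)⁻¹ : PowerSeries ℚ) * (PowerSeries.exp ℚ + 1) = 2 := by
    rw [mul_assoc, PowerSeries.inv_mul_cancel, mul_one]
    simp
  have h' := congrArg (PowerSeries.map (Polynomial.C : ℚ →+* Polynomial ℚ)) h
  rw [map_mul, map_add, PowerSeries.map_exp, map_one, map_ofNat] at h'
  rw [eulerPolyGF, mul_right_comm, h']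

/-- The Euler polynomials: `2 e^{xt} / (e^t + 1) = ∑ E_n(x) t^n / n!`. -/
noncomputable def eulerPoly (n : ℕ) : Polynomial ℚ :=
  (n ! : Polynomial ℚ) * PowerSeries.coeff n eulerPolyGF

/-- The sequence `k E_{k-1}`, `k = 0, 1, 2, …`, of rational numbers; the term with `k = 0` is `0`
because of the factor `k`. -/
noncomputable def eulerNumberSeq (k : ℕ) : ℚ := (k : ℚ) * eulerNumber (k - 1)

/-- The sequence `k E_{k-1}(x)`, `k = 0, 1, 2, …`, of polynomials; the term with `k = 0` is `0`
because of the factor `k`. -/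
noncomputable def eulerPolySeq (k : ℕ) : Polynomial ℚ := (k : Polynomial ℚ) * eulerPoly (k - 1)

end EulerHankel

namespace EulerHankel

open Polynomial

/-! ### Hankel, checkerboard and factorial determinants -/

section Determinants

variable {R : Type*} [CommRing R]

/-! Let `M` be the linear functional with moments `M (X ^ k)` equal to the given sequence. If G is
the generating function of the Euler numbers or polynomials, the moments have exponential generating
function tG, and G(e^{ht} + e^{-ht}) = 2e^{at} says exactly that M(p(X+h)) + M(p(X-h)) = 2p'(a). The
Euler numbers have a = 0, h = 1; the Euler polynomials a = x - 1/2, h = 1/2.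

A unitriangular change of basis replaces the Hankel matrix by the Gram matrix of any monic basis.
Take q_j, with zeros at odd multiples of h from a, and (X-a)q_j. Then M kills q_i q_j and (X-a)²q_i
q_j, so the Gram matrix is a checkerboard: singular in odd size, and in even size governed by the
square of one determinant. Its entries M((X-a)q_i q_j) are a rank-one factor times (i+j)!
(`functional_mul_oddNodePoly_mul`), so it is evaluated by `det_mul_factorial_add`. -/

theorem hankelDet_eq_det_of_monic (M : R[X] →ₗ[R] R) (n : ℕ) (b : ℕ → R[X])
    (hdeg : ∀ i, (b i).natDegree = i) (hmonic : ∀ i, (b i).Monic) :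
    hankelDet n (fun k => M (X ^ k)) =
      (Matrix.of fun i j : Fin (n + 1) => M (b i * b j)).det := by
  set B : Matrix (Fin (n + 1)) (Fin (n + 1)) R := Matrix.of fun i j => (b j).coeff i with hB
  have hdet : B.det = 1 :=
    Matrix.det_matrixOfPolynomials (fun i : Fin (n + 1) => b i) (fun i => hdeg i)
      (fun i => hmonic i)
  have hexp : ∀ k : Fin (n + 1), b k = ∑ i : Fin (n + 1), C ((b k).coeff i) * X ^ (i : ℕ) := by
    intro k
    rw [Fin.sum_univ_eq_sum_range (fun i => C ((b k).coeff i) * X ^ i)]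
    exact as_sum_range_C_mul_X_pow' _ (by rw [hdeg]; exact k.2)
  have hmul : (Matrix.of fun i j : Fin (n + 1) => M (b i * b j)) =
      B.transpose * (Matrix.of fun i j : Fin (n + 1) => M (X ^ ((i : ℕ) + (j : ℕ)))) * B := by
    ext k l
    rw [Matrix.of_apply, hexp k, hexp l, Finset.sum_mul_sum, map_sum, Matrix.mul_apply]
    simp_rw [map_sum, Matrix.mul_apply, Finset.sum_mul]
    rw [Finset.sum_comm]
    refine Finset.sum_congr rfl fun j _ => Finset.sum_congr rfl fun i _ => ?_
    have : C ((b k).coeff i) * X ^ (i : ℕ) * (C ((b l).coeff j) * X ^ (j : ℕ)) =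
        ((b k).coeff i * (b l).coeff j) • (X : R[X]) ^ ((i : ℕ) + (j : ℕ)) := by
      rw [smul_eq_C_mul, C_mul]; ring
    rw [this, map_smul, smul_eq_mul, hB]
    simp only [Matrix.transpose_apply, Matrix.of_apply]
    ring
  rw [hmul, Matrix.det_mul, Matrix.det_mul, Matrix.det_transpose, hdet, hankelDet]
  simp

/-- An odd-sized matrix supported on the entries of odd index sum is singular. -/
theorem det_eq_zero_of_checkerboard [IsDomain R] [CharZero R] (m : ℕ) (g : ℕ → ℕ → R)
    (hg : ∀ i j, Even (i + j) → g i j = 0) :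
    (Matrix.of fun i j : Fin (2 * m + 1) => g i j).det = 0 := by
  set A := Matrix.of fun i j : Fin (2 * m + 1) => g i j with hA
  set D : Matrix (Fin (2 * m + 1)) (Fin (2 * m + 1)) R :=
    Matrix.diagonal fun i => (-1) ^ (i : ℕ) with hD
  -- Conjugation by alternating signs negates the entries of odd index sum; in odd size this forces
  -- det A = -det A.
  have h : D * A * D = -A := by
    ext i j
    rw [hD, Matrix.mul_diagonal, Matrix.diagonal_mul, hA, Matrix.neg_apply, Matrix.of_apply]
    rcases Nat.even_or_odd ((i : ℕ) + j) with he | ho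
    · rw [hg _ _ he]; ring
    · rw [mul_right_comm, ← pow_add, ho.neg_one_pow]; ring
  have hDD : D.det * D.det = 1 := by
    rw [← Matrix.det_mul, hD, Matrix.diagonal_mul_diagonal]
    simp [← mul_pow]
  have h2 := congrArg Matrix.det h
  rw [Matrix.det_mul, Matrix.det_mul, Matrix.det_neg, Fintype.card_fin, mul_right_comm, hDD,
    (odd_two_mul_add_one m).neg_one_pow] at h2
  exact self_eq_neg.mp (by simpa using h2)

/-- Two block row operations give a block upper triangular matrix with diagonal blocks A and -A. -/
theorem det_fromBlocks_antidiagonal {n : Type*} [Fintype n] [DecidableEq n] (A : Matrix n n R) :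
    (Matrix.fromBlocks 0 A A 0).det = (-1) ^ Fintype.card n * A.det ^ 2 := by
  have h : Matrix.fromBlocks (1 : Matrix n n R) 0 (-1) 1 *
      (Matrix.fromBlocks (1 : Matrix n n R) 1 0 1 * Matrix.fromBlocks 0 A A 0) =
      Matrix.fromBlocks A A 0 (-A) := by
    simp [Matrix.fromBlocks_multiply]
  have h2 := congrArg Matrix.det h
  rw [Matrix.det_mul, Matrix.det_mul, Matrix.det_fromBlocks_zero₁₂,
    Matrix.det_fromBlocks_zero₂₁, Matrix.det_fromBlocks_zero₂₁, Matrix.det_neg] at h2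
  simp only [Matrix.det_one, one_mul] at h2
  rw [h2]; ring

/-- Listing even indices before odd ones makes the matrix block antidiagonal. -/
theorem det_checkerboard (m : ℕ) (g : ℕ → ℕ → R) (a : ℕ → ℕ → R)
    (hee : ∀ i j, g (2 * i) (2 * j) = 0) (heo : ∀ i j, g (2 * i) (2 * j + 1) = a i j)
    (hoe : ∀ i j, g (2 * i + 1) (2 * j) = a i j) (hoo : ∀ i j, g (2 * i + 1) (2 * j + 1) = 0) :
    (Matrix.of fun i j : Fin (2 * m + 1 + 1) => g i j).det =
      (-1) ^ (m + 1) * (Matrix.of fun i j : Fin (m + 1) => a i j).det ^ 2 := by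
  let f : Fin (m + 1) ⊕ Fin (m + 1) → Fin (2 * m + 1 + 1) :=
    Sum.elim (fun i => ⟨2 * i, by omega⟩) (fun i => ⟨2 * i + 1, by omega⟩)
  have hf : Function.Bijective f := by
    rw [Fintype.bijective_iff_injective_and_card]
    refine ⟨?_, by simp; ring⟩
    rintro (i | i) (j | j) hij <;>
      simp only [f, Sum.elim_inl, Sum.elim_inr, Sum.inl.injEq, Sum.inr.injEq,
        Fin.ext_iff, reduceCtorEq] at hij ⊢ <;> omega
  rw [← Matrix.det_submatrix_equiv_self (Equiv.ofBijective f hf)]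
  have h : (Matrix.of fun i j : Fin (2 * m + 1 + 1) => g i j).submatrix
      (Equiv.ofBijective f hf) (Equiv.ofBijective f hf) =
      Matrix.fromBlocks 0 (Matrix.of fun i j : Fin (m + 1) => a i j)
        (Matrix.of fun i j : Fin (m + 1) => a i j) 0 := by
    ext (i | i) (j | j) <;> simp [f, hee, heo, hoe, hoo]
  rw [h, det_fromBlocks_antidiagonal, Fintype.card_fin]

/-- Vandermonde's identity factors the matrix as P Pᵀ, with P the unitriangular Pascal matrix. -/
theorem det_choose_add (n : ℕ) :
    (Matrix.of fun i j : Fin n => (((i : ℕ) + j).choose i : R)).det = 1 := by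
  set P : Matrix (Fin n) (Fin n) R := Matrix.of fun i j => ((i : ℕ).choose j : R) with hP
  have hdet : P.det = 1 := by
    rw [Matrix.det_of_isLowerTriangular]
    · simp [hP]
    · intro i j hij
      have : (i : ℕ) < j := hij
      simp [hP, Nat.choose_eq_zero_of_lt this]
  have h : (Matrix.of fun i j : Fin n => (((i : ℕ) + j).choose i : R)) = P * P.transpose := by
    ext i j
    rw [Matrix.mul_apply]
    simp only [hP, Matrix.of_apply, Matrix.transpose_apply]
    rw [Fin.sum_univ_eq_sum_range (fun k => (((i : ℕ).choose k : R) * ((j : ℕ).choose k : R))),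
      Nat.add_choose_eq, Finset.Nat.sum_antidiagonal_eq_sum_range_succ_mk]
    push_cast
    rw [← Finset.sum_range_reflect]
    refine Eq.trans (Finset.sum_congr rfl fun k hk => ?_)
      (Finset.sum_subset (Finset.range_subset_range.2 (Nat.succ_le_of_lt i.2)) fun k _ hk => ?_)
    · have hk' : k ≤ i := Nat.lt_succ_iff.mp (Finset.mem_range.mp hk)
      have h1 : (i : ℕ) + 1 - 1 - k = i - k := by omega
      have h2 : (i : ℕ) - (i - k) = k := by omega
      simp only [Nat.succ_eq_add_one, h1, h2, Nat.choose_symm hk']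
    · have : (i : ℕ) < k := by simpa using hk
      simp [Nat.choose_eq_zero_of_lt this]
  rw [h, Matrix.det_mul, Matrix.det_transpose, hdet, one_mul]

theorem det_mul_factorial_add (n : ℕ) (f : ℕ → R) :
    (Matrix.of fun i j : Fin n => f i * f j * ((((i : ℕ) + j)! : ℕ) : R)).det =
      ∏ i ∈ Finset.range n, (f i * (i ! : R)) ^ 2 := by
  set D : Matrix (Fin n) (Fin n) R := Matrix.diagonal fun i => f i * ((i : ℕ)! : R) with hD
  have h : (Matrix.of fun i j : Fin n => f i * f j * ((((i : ℕ) + j)! : ℕ) : R)) =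
      D * (Matrix.of fun i j : Fin n => (((i : ℕ) + j).choose i : R)) * D := by
    ext i j
    rw [hD, Matrix.mul_diagonal, Matrix.diagonal_mul, Matrix.of_apply, Matrix.of_apply,
      ← Nat.add_choose_mul_factorial_mul_factorial, Nat.choose_symm_add]
    push_cast
    ring
  rw [h, Matrix.det_mul, Matrix.det_mul, det_choose_add, hD, Matrix.det_diagonal,
    Fin.prod_univ_eq_prod_range (fun i => f i * (i ! : R)), Finset.prod_pow]
  ring

end Determinants

/-! ### The functional equation and its adapted basis -/

section Functional

variable {R : Type*} [CommRing R]

/-- `∏_{r<j} ((X - a)² - ((2r+1)h)²)`. -/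
noncomputable def oddNodePoly (a h : R) (j : ℕ) : R[X] :=
  ∏ r ∈ Finset.range j, ((X - C a) ^ 2 - C (((2 * r + 1) * h) ^ 2))

/-- `(X - a) ∏_{r<j} ((X - a)² - ((2r+2)h)²)`. -/
noncomputable def evenNodePoly (a h : R) (j : ℕ) : R[X] :=
  (X - C a) * ∏ r ∈ Finset.range j, ((X - C a) ^ 2 - C (((2 * r + 2) * h) ^ 2))

theorem oddNodePoly_succ (a h : R) (j : ℕ) :
    oddNodePoly a h (j + 1) =
      oddNodePoly a h j * ((X - C a) ^ 2 - C (((2 * j + 1) * h) ^ 2)) := by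
  rw [oddNodePoly, Finset.prod_range_succ, oddNodePoly]

theorem evenNodePoly_succ (a h : R) (j : ℕ) :
    evenNodePoly a h (j + 1) =
      evenNodePoly a h j * ((X - C a) ^ 2 - C (((2 * j + 2) * h) ^ 2)) := by
  rw [evenNodePoly, Finset.prod_range_succ, evenNodePoly, mul_assoc]

/-- The 2j+1 even nodes, shifted by -h, become the zeros of q_j together with a - (2j+1)h. -/
theorem evenNodePoly_comp_add (a h : R) (j : ℕ) :
    (evenNodePoly a h j).comp (X + C h) =
      oddNodePoly a h j * (X - C a + C ((2 * j + 1) * h)) := by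
  induction j with
  | zero => simp [evenNodePoly, oddNodePoly]; ring
  | succ j ih =>
    rw [evenNodePoly_succ, mul_comp, ih, oddNodePoly_succ]
    simp only [sub_comp, pow_comp, X_comp, C_comp]
    push_cast
    simp only [C_mul, C_add, C_pow, C_1, C_ofNat]
    ring

theorem evenNodePoly_comp_sub (a h : R) (j : ℕ) :
    (evenNodePoly a h j).comp (X - C h) =
      oddNodePoly a h j * (X - C a - C ((2 * j + 1) * h)) := by
  -- Both families depend on h only through h², so this is the previous identity at -h.
  have h1 : ∀ j, oddNodePoly a (-h) j = oddNodePoly a h j := fun j => by simp [oddNodePoly]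
  have h2 : ∀ j, evenNodePoly a (-h) j = evenNodePoly a h j := fun j => by simp [evenNodePoly]
  have := evenNodePoly_comp_add a (-h) j
  rw [h1, h2] at this
  simpa [sub_eq_add_neg] using this

theorem eval_derivative_evenNodePoly (a h : R) (j : ℕ) :
    (derivative (evenNodePoly a h j)).eval a = (-1) ^ j * (2 * h) ^ (2 * j) * (j ! : R) ^ 2 := by
  have : (derivative (evenNodePoly a h j)).eval a =
      ∏ r ∈ Finset.range j, (-((2 * r + 2) * h) ^ 2) := by
    simp [evenNodePoly, derivative_mul, eval_prod]
  rw [this]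
  induction j with
  | zero => simp
  | succ j ih =>
    rw [Finset.prod_range_succ, ih ?_, Nat.factorial_succ]
    · push_cast; ring
    · simp [evenNodePoly, derivative_mul, eval_prod]

/-- The coefficient is ((2j+1)² - (2i+1)²)h². This trade of i+1 for j+1 drives the inductions on i
below. -/
theorem oddNodePoly_mul_succ (a h : R) (i j : ℕ) :
    oddNodePoly a h (i + 1) * oddNodePoly a h j =
      oddNodePoly a h i * oddNodePoly a h (j + 1) +
        ((2 * h) ^ 2 * (((j : R) - i) * (i + j + 1))) • (oddNodePoly a h i * oddNodePoly a h j) := by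
  rw [oddNodePoly_succ, oddNodePoly_succ, smul_eq_C_mul]
  simp only [C_mul, C_add, C_sub, C_pow, C_1, C_ofNat]
  ring

/-- The monic basis `q_0, (X - a) q_0, q_1, (X - a) q_1, …` with `q_j = oddNodePoly a h j`. -/
noncomputable def adaptedBasis (a h : R) (k : ℕ) : R[X] :=
  (X - C a) ^ (k % 2) * oddNodePoly a h (k / 2)

theorem adaptedBasis_two_mul (a h : R) (i : ℕ) :
    adaptedBasis a h (2 * i) = oddNodePoly a h i := by
  simp [adaptedBasis]

theorem adaptedBasis_two_mul_add_one (a h : R) (i : ℕ) :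
    adaptedBasis a h (2 * i + 1) = (X - C a) * oddNodePoly a h i := by
  rw [adaptedBasis, show (2 * i + 1) % 2 = 1 by omega, show (2 * i + 1) / 2 = i by omega, pow_one]

theorem sq_sub_C_eq (a c : R) :
    (X - C a) ^ 2 - C (c ^ 2) = (X - C (a + c)) * (X - C (a - c)) := by
  simp only [C_add, C_sub, C_pow]; ring

theorem monic_oddNodePoly (a h : R) (j : ℕ) : (oddNodePoly a h j).Monic :=
  monic_prod_of_monic _ _ fun r _ => by
    rw [sq_sub_C_eq]; exact (monic_X_sub_C _).mul (monic_X_sub_C _)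

theorem natDegree_oddNodePoly [Nontrivial R] (a h : R) (j : ℕ) : (oddNodePoly a h j).natDegree = 2 * j := by
  induction j with
  | zero => simp [oddNodePoly]
  | succ j ih =>
    rw [oddNodePoly_succ, sq_sub_C_eq, Monic.natDegree_mul (monic_oddNodePoly a h j)
      ((monic_X_sub_C _).mul (monic_X_sub_C _)),
      Monic.natDegree_mul (monic_X_sub_C _) (monic_X_sub_C _), ih,
      natDegree_X_sub_C, natDegree_X_sub_C]
    ring

theorem monic_adaptedBasis (a h : R) (k : ℕ) : (adaptedBasis a h k).Monic :=
  ((monic_X_sub_C a).pow _).mul (monic_oddNodePoly a h _)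

theorem natDegree_adaptedBasis [Nontrivial R] (a h : R) (k : ℕ) : (adaptedBasis a h k).natDegree = k := by
  rw [adaptedBasis, Monic.natDegree_mul ((monic_X_sub_C a).pow _) (monic_oddNodePoly a h _),
    Monic.natDegree_pow (monic_X_sub_C a), natDegree_oddNodePoly]
  simp; omega

variable [IsDomain R] [CharZero R] {a h : R} {M : R[X] →ₗ[R] R}

/-- The even-node polynomial is the test polynomial: its two shifts sum to 2(X-a)q_j. -/
theorem functional_mul_oddNodePoly
    (hM : ∀ p : R[X], M (p.comp (X + C h)) + M (p.comp (X - C h)) = 2 * (derivative p).eval a)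
    (j : ℕ) :
    M ((X - C a) * oddNodePoly a h j) = (-1) ^ j * (2 * h) ^ (2 * j) * (j ! : R) ^ 2 := by
  have := hM (evenNodePoly a h j)
  rw [eval_derivative_evenNodePoly, ← map_add, evenNodePoly_comp_add, evenNodePoly_comp_sub] at this
  have h2 : oddNodePoly a h j * (X - C a + C ((2 * j + 1) * h)) +
      oddNodePoly a h j * (X - C a - C ((2 * j + 1) * h)) =
      (2 : R) • ((X - C a) * oddNodePoly a h j) := by
    rw [smul_eq_C_mul, C_ofNat]; ring
  rw [h2, map_smul, smul_eq_mul] at this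
  exact mul_left_cancel₀ two_ne_zero this

theorem functional_oddNodePoly
    (hM : ∀ p : R[X], M (p.comp (X + C h)) + M (p.comp (X - C h)) = 2 * (derivative p).eval a)
    (j : ℕ) : M (oddNodePoly a h j) = 0 := by
  induction j with
  | zero =>
    have := hM 1
    simpa [← two_mul, oddNodePoly] using this
  | succ j ih =>
    -- This polynomial has a double zero at a, and its shifts sum to 2q_{j+1} plus a multiple of
    -- q_j.
    have := hM ((X - C a) * evenNodePoly a h j)
    rw [← map_add, mul_comp, mul_comp, evenNodePoly_comp_add, evenNodePoly_comp_sub] at this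
    have h2 : (X - C a).comp (X + C h) * (oddNodePoly a h j * (X - C a + C ((2 * j + 1) * h))) +
        (X - C a).comp (X - C h) * (oddNodePoly a h j * (X - C a - C ((2 * j + 1) * h))) =
        (2 : R) • oddNodePoly a h (j + 1) +
        (2 * ((2 * j + 1) * h) ^ 2 + 2 * (2 * j + 1) * h ^ 2) • oddNodePoly a h j := by
      rw [smul_eq_C_mul, smul_eq_C_mul, oddNodePoly_succ]
      simp only [sub_comp, X_comp, C_comp, C_mul, C_add, C_pow, C_1, C_ofNat]
      ring
    have h3 : (derivative ((X - C a) * evenNodePoly a h j)).eval a = 0 := by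
      simp [derivative_mul, evenNodePoly]
    rw [h2, map_add, map_smul, map_smul, ih, h3, smul_zero, add_zero, mul_zero] at this
    simpa using this

theorem functional_oddNodePoly_mul
    (hM : ∀ p : R[X], M (p.comp (X + C h)) + M (p.comp (X - C h)) = 2 * (derivative p).eval a)
    (i j : ℕ) : M (oddNodePoly a h i * oddNodePoly a h j) = 0 := by
  induction i generalizing j with
  | zero => simpa [oddNodePoly] using functional_oddNodePoly hM j
  | succ i ih => rw [oddNodePoly_mul_succ, map_add, map_smul, ih, ih, smul_zero, add_zero]

theorem functional_sq_mul_oddNodePoly_mul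
    (hM : ∀ p : R[X], M (p.comp (X + C h)) + M (p.comp (X - C h)) = 2 * (derivative p).eval a)
    (i j : ℕ) : M ((X - C a) ^ 2 * (oddNodePoly a h i * oddNodePoly a h j)) = 0 := by
  have : (X - C a) ^ 2 * (oddNodePoly a h i * oddNodePoly a h j) =
      oddNodePoly a h (i + 1) * oddNodePoly a h j +
        (((2 * i + 1) * h) ^ 2) • (oddNodePoly a h i * oddNodePoly a h j) := by
    rw [oddNodePoly_succ, smul_eq_C_mul]; ring
  rw [this, map_add, map_smul, functional_oddNodePoly_mul hM, functional_oddNodePoly_mul hM,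
    smul_zero, add_zero]

theorem functional_mul_oddNodePoly_mul
    (hM : ∀ p : R[X], M (p.comp (X + C h)) + M (p.comp (X - C h)) = 2 * (derivative p).eval a)
    (i j : ℕ) : M ((X - C a) * (oddNodePoly a h i * oddNodePoly a h j)) =
      ((-1) ^ i * (2 * h) ^ (2 * i) * (i ! : R)) * ((-1) ^ j * (2 * h) ^ (2 * j) * (j ! : R)) *
        (((i + j)! : ℕ) : R) := by
  induction i generalizing j with
  | zero =>
    have := functional_mul_oddNodePoly hM j
    simp only [oddNodePoly, Finset.range_zero, Finset.prod_empty, one_mul] at this ⊢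
    rw [this]
    simp only [zero_add, pow_zero, mul_zero, Nat.factorial_zero]
    push_cast; ring
  | succ i ih =>
    rw [oddNodePoly_mul_succ, mul_add, mul_smul_comm, map_add, map_smul, ih, ih, smul_eq_mul,
      show i + 1 + j = i + j + 1 by ring, show i + (j + 1) = i + j + 1 by ring,
      Nat.factorial_succ (i + j), Nat.factorial_succ i, Nat.factorial_succ j]
    push_cast
    ring

theorem functional_adaptedBasis_even_even
    (hM : ∀ p : R[X], M (p.comp (X + C h)) + M (p.comp (X - C h)) = 2 * (derivative p).eval a)
    (i j : ℕ) : M (adaptedBasis a h (2 * i) * adaptedBasis a h (2 * j)) = 0 := by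
  rw [adaptedBasis_two_mul, adaptedBasis_two_mul, functional_oddNodePoly_mul hM]

theorem functional_adaptedBasis_odd_odd
    (hM : ∀ p : R[X], M (p.comp (X + C h)) + M (p.comp (X - C h)) = 2 * (derivative p).eval a)
    (i j : ℕ) : M (adaptedBasis a h (2 * i + 1) * adaptedBasis a h (2 * j + 1)) = 0 := by
  rw [adaptedBasis_two_mul_add_one, adaptedBasis_two_mul_add_one, mul_mul_mul_comm, ← sq,
    functional_sq_mul_oddNodePoly_mul hM]

theorem hankelDet_two_mul_of_functional
    (hM : ∀ p : R[X], M (p.comp (X + C h)) + M (p.comp (X - C h)) = 2 * (derivative p).eval a)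
    (m : ℕ) : hankelDet (2 * m) (fun k => M (X ^ k)) = 0 := by
  rw [hankelDet_eq_det_of_monic M _ (adaptedBasis a h) (natDegree_adaptedBasis a h)
    (monic_adaptedBasis a h)]
  refine det_eq_zero_of_checkerboard m (fun i j => M (adaptedBasis a h i * adaptedBasis a h j)) ?_
  intro i j hij
  rcases Nat.even_or_odd' i with ⟨s, rfl | rfl⟩ <;> rcases Nat.even_or_odd' j with ⟨t, rfl | rfl⟩
  · exact functional_adaptedBasis_even_even hM s t
  · rw [Nat.even_iff] at hij; omega
  · rw [Nat.even_iff] at hij; omega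
  · exact functional_adaptedBasis_odd_odd hM s t

theorem hankelDet_two_mul_add_one_of_functional
    (hM : ∀ p : R[X], M (p.comp (X + C h)) + M (p.comp (X - C h)) = 2 * (derivative p).eval a)
    (m : ℕ) : hankelDet (2 * m + 1) (fun k => M (X ^ k)) =
      (-1) ^ (m + 1) * (2 * h) ^ (4 * m * (m + 1)) * ∏ l ∈ Finset.Icc 1 m, (l ! : R) ^ 8 := by
  rw [hankelDet_eq_det_of_monic M _ (adaptedBasis a h) (natDegree_adaptedBasis a h)
    (monic_adaptedBasis a h)]
  rw [det_checkerboard m (fun i j => M (adaptedBasis a h i * adaptedBasis a h j))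
    (fun i j => ((-1) ^ i * (2 * h) ^ (2 * i) * (i ! : R)) *
      ((-1) ^ j * (2 * h) ^ (2 * j) * (j ! : R)) * (((i + j)! : ℕ) : R))
    (functional_adaptedBasis_even_even hM) ?_ ?_ (functional_adaptedBasis_odd_odd hM),
    det_mul_factorial_add (m + 1) (fun i => (-1) ^ i * (2 * h) ^ (2 * i) * (i ! : R)), mul_assoc]
  -- After squaring, index i contributes (2h)^{8i} i!^8, and the exponents 8i sum to 4m(m+1).
  · congr 1
    induction m with
    | zero => simp
    | succ m ih =>
      rw [Finset.prod_range_succ, mul_pow, ih, Finset.prod_Icc_succ_top (by omega)]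
      have h1 : ((-1 : R) ^ (m + 1)) ^ 4 = 1 := by
        rw [← pow_mul]; exact Even.neg_one_pow ⟨2 * (m + 1), by ring⟩
      have h2 : 4 * (m + 1) * (m + 1 + 1) = 4 * m * (m + 1) + 2 * (m + 1) * 4 := by ring
      rw [h2, pow_add (2 * h), pow_mul (2 * h) (2 * (m + 1)) 4]
      linear_combination ((2 * h) ^ (4 * m * (m + 1)) * (∏ l ∈ Finset.Icc 1 m, (l ! : R) ^ 8) *
        ((2 * h) ^ (2 * (m + 1))) ^ 4 * ((m + 1)! : R) ^ 8) * h1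
  · intro i j
    rw [adaptedBasis_two_mul, adaptedBasis_two_mul_add_one, mul_left_comm,
      functional_mul_oddNodePoly_mul hM]
  · intro i j
    rw [adaptedBasis_two_mul, adaptedBasis_two_mul_add_one, mul_assoc,
      functional_mul_oddNodePoly_mul hM]

end Functional

/-! ### From generating functions to the functional equation -/

section GeneratingFunction

variable {R : Type*} [CommRing R]

theorem exists_functional (c : ℕ → R) : ∃ M : R[X] →ₗ[R] R, ∀ k, M (X ^ k) = c k :=
  ⟨(basisMonomials R).constr R c, fun k => by
    rw [X_pow_eq_monomial]
    exact (basisMonomials R).constr_basis R c k⟩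

variable [Algebra ℚ R]

theorem factorial_mul_coeff_mul_rescale_exp (F : PowerSeries R) (h : R) (n : ℕ) :
    (n ! : R) * PowerSeries.coeff n (F * PowerSeries.rescale h (PowerSeries.exp R)) =
      ∑ k ∈ Finset.range (n + 1), ((k ! : R) * PowerSeries.coeff k F) * h ^ (n - k) *
        (n.choose k : R) := by
  rw [PowerSeries.coeff_mul, Finset.Nat.sum_antidiagonal_eq_sum_range_succ_mk, Finset.mul_sum]
  refine Finset.sum_congr rfl fun k hk => ?_
  have hk' : k ≤ n := Nat.lt_succ_iff.mp (Finset.mem_range.mp hk)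
  have hf : (((n - k)! : ℕ) : R) * algebraMap ℚ R (1 / (n - k)!) = 1 := by
    rw [← map_natCast (algebraMap ℚ R), ← map_mul, mul_one_div_cancel, map_one]
    exact_mod_cast (n - k).factorial_ne_zero
  rw [PowerSeries.coeff_rescale, PowerSeries.coeff_exp, ← Nat.choose_mul_factorial_mul_factorial hk']
  push_cast
  linear_combination ((n.choose k : R) * (k ! : R) * PowerSeries.coeff k F * h ^ (n - k)) * hf

/-- Translating the argument by h multiplies the moment generating function by e^{ht}. -/
theorem functional_X_add_C_pow (M : R[X] →ₗ[R] R) (F : PowerSeries R)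
    (hF : ∀ k, M (X ^ k) = (k ! : R) * PowerSeries.coeff k F) (h : R) (n : ℕ) :
    M ((X + C h) ^ n) =
      (n ! : R) * PowerSeries.coeff n (F * PowerSeries.rescale h (PowerSeries.exp R)) := by
  rw [factorial_mul_coeff_mul_rescale_exp, add_pow, map_sum]
  refine Finset.sum_congr rfl fun k _ => ?_
  have : (X : R[X]) ^ k * C h ^ (n - k) * (n.choose k : R[X]) =
      (h ^ (n - k) * (n.choose k : R)) • X ^ k := by
    rw [smul_eq_C_mul, C_mul, C_pow, C_eq_natCast]; ring
  rw [this, map_smul, smul_eq_mul, hF]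
  ring

theorem functional_comp_add_comp_sub (M : R[X] →ₗ[R] R) (G : PowerSeries R) (a h : R)
    (hF : ∀ k, M (X ^ k) = (k ! : R) * PowerSeries.coeff k (PowerSeries.X * G))
    (hG : G * (PowerSeries.rescale h (PowerSeries.exp R) +
      PowerSeries.rescale (-h) (PowerSeries.exp R)) =
        2 * PowerSeries.rescale a (PowerSeries.exp R)) (p : R[X]) :
    M (p.comp (X + C h)) + M (p.comp (X - C h)) = 2 * (derivative p).eval a := by
  induction p using Polynomial.induction_on' with
  | add p q hp hq =>
    simp only [add_comp, map_add, eval_add]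
    linear_combination hp + hq
  | monomial n r =>
    have key : M ((X + C h) ^ n) + M ((X + C (-h)) ^ n) = 2 * (n * a ^ (n - 1)) := by
      rw [functional_X_add_C_pow M _ hF, functional_X_add_C_pow M _ hF, ← mul_add, ← map_add,
        ← mul_add, mul_assoc, hG, ← map_ofNat (PowerSeries.C (R := R)) 2]
      cases n with
      | zero => simp
      | succ n =>
        have hf : ((n ! : ℕ) : R) * algebraMap ℚ R (1 / n !) = 1 := by
          rw [← map_natCast (algebraMap ℚ R), ← map_mul, mul_one_div_cancel, map_one]
          exact_mod_cast n.factorial_ne_zero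
        rw [PowerSeries.coeff_succ_X_mul, PowerSeries.coeff_C_mul, PowerSeries.coeff_rescale,
          PowerSeries.coeff_exp, Nat.factorial_succ, Nat.add_sub_cancel]
        push_cast
        linear_combination (2 * ((n : R) + 1) * a ^ n) * hf
    rw [C_neg, ← sub_eq_add_neg] at key
    rw [monomial_comp, monomial_comp, ← smul_eq_C_mul, ← smul_eq_C_mul, map_smul, map_smul,
      derivative_monomial, eval_monomial, smul_eq_mul, smul_eq_mul]
    linear_combination r * key

theorem hankelDet_of_generatingFunction [IsDomain R] [CharZero R] (G : PowerSeries R) (a h : R)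
    (hG : G * (PowerSeries.rescale h (PowerSeries.exp R) +
      PowerSeries.rescale (-h) (PowerSeries.exp R)) =
        2 * PowerSeries.rescale a (PowerSeries.exp R)) (m : ℕ) :
    hankelDet (2 * m)
      (fun k => (k : R) * (((k - 1)! : ℕ) * PowerSeries.coeff (k - 1) G)) = 0 ∧
    hankelDet (2 * m + 1)
      (fun k => (k : R) * (((k - 1)! : ℕ) * PowerSeries.coeff (k - 1) G)) =
      (-1) ^ (m + 1) * (2 * h) ^ (4 * m * (m + 1)) * ∏ l ∈ Finset.Icc 1 m, (l ! : R) ^ 8 := by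
  obtain ⟨M, hc⟩ := exists_functional
    (fun k => (k : R) * (((k - 1)! : ℕ) * PowerSeries.coeff (k - 1) G))
  have hM := functional_comp_add_comp_sub M G a h (fun k => by
    rw [hc]
    cases k with
    | zero => simp
    | succ k =>
      rw [PowerSeries.coeff_succ_X_mul, Nat.add_sub_cancel, Nat.factorial_succ]
      push_cast
      ring) hG
  have hseq := funext hc
  rw [← hseq]
  exact ⟨hankelDet_two_mul_of_functional hM m, hankelDet_two_mul_add_one_of_functional hM m⟩

end GeneratingFunction

/-! ### Specialization to Euler numbers and polynomials -/

theorem eulerNumberGF_mul_rescale :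
    eulerNumberGF * (PowerSeries.rescale 1 (PowerSeries.exp ℚ) +
      PowerSeries.rescale (-1) (PowerSeries.exp ℚ)) =
        2 * PowerSeries.rescale 0 (PowerSeries.exp ℚ) := by
  have h := eulerNumberGF_mul
  rw [PowerSeries.evalNegHom] at h
  rw [PowerSeries.rescale_one, RingHom.id_apply, h, PowerSeries.rescale_zero]
  simp

theorem eulerPolyGF_mul_rescale :
    eulerPolyGF * (PowerSeries.rescale (C (1 / 2)) (PowerSeries.exp ℚ[X]) +
      PowerSeries.rescale (-C (1 / 2)) (PowerSeries.exp ℚ[X])) =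
        2 * PowerSeries.rescale (X - C (1 / 2)) (PowerSeries.exp ℚ[X]) := by
  -- Multiplying by e^{-t/2} symmetrizes e^t + 1.
  have h := congrArg (· * PowerSeries.rescale (-C (1 / 2)) (PowerSeries.exp ℚ[X])) eulerPolyGF_mul
  have h1 : PowerSeries.exp ℚ[X] * PowerSeries.rescale (-C (1 / 2)) (PowerSeries.exp ℚ[X]) =
      PowerSeries.rescale (C (1 / 2)) (PowerSeries.exp ℚ[X]) := by
    have := PowerSeries.exp_mul_exp_eq_exp_add (1 : ℚ[X]) (-C (1 / 2))
    rw [PowerSeries.rescale_one, RingHom.id_apply] at this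
    rw [this, ← C_1, ← C_neg, ← C_add]
    norm_num
  have h2 := PowerSeries.exp_mul_exp_eq_exp_add (X : ℚ[X]) (-C (1 / 2))
  rw [← sub_eq_add_neg] at h2
  simp only [mul_assoc, add_mul, one_mul, h1, h2] at h
  exact h

end EulerHankel

theorem corollary3p4 (m : ℕ) :
    EulerHankel.hankelDet (2 * m) EulerHankel.eulerPolySeq = 0 ∧
    EulerHankel.hankelDet (2 * m) EulerHankel.eulerNumberSeq = 0 ∧
    EulerHankel.hankelDet (2 * m + 1) EulerHankel.eulerPolySeq =
      (-1) ^ (m + 1) * ∏ l ∈ Finset.Icc 1 m, (l ! : Polynomial ℚ) ^ 8 ∧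
    EulerHankel.hankelDet (2 * m + 1) EulerHankel.eulerNumberSeq =
      (-1) ^ (m + 1) * 2 ^ (4 * m * (m + 1)) * ∏ l ∈ Finset.Icc 1 m, (l ! : ℚ) ^ 8 := by
  obtain ⟨hp, hp'⟩ := EulerHankel.hankelDet_of_generatingFunction _ _ _
    EulerHankel.eulerPolyGF_mul_rescale m
  obtain ⟨hn, hn'⟩ := EulerHankel.hankelDet_of_generatingFunction _ _ _
    EulerHankel.eulerNumberGF_mul_rescale m
  have hone : (2 * Polynomial.C (1 / 2) : Polynomial ℚ) = 1 := by
    rw [← Polynomial.C_ofNat, ← Polynomial.C_mul]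
    norm_num
  rw [hone, one_pow, mul_one] at hp'
  rw [mul_one] at hn'
  exact ⟨hp, hn, hp', hn'⟩
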